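/- Let $H$ be a complex Hilbert space, let $X\subseteq B(H)$ be a linear subspace containing the identity operator $1$, and let $C^*(X)\subseteq B(H)$ be the C*-algebra generated by $X$. Matrices over $B(H)$ carry the norms given by $M_\nu(B(H))\cong B(H^\nu)$. A linear map $\phi\colon C^*(X)\to B(H)$ is called ucc (unital completely contractive) if $\phi(1)=1$ and $\|[\phi(c_{ij})]\|\le\|[c_{ij}]\|$ for every $\nu$ and every $[c_{ij}]\in M_\nu(C^*(X))$. A closed two-sided ideal $I$ of $C^*(X)$ is called boundary if the quotient map $C^*(X)\to C^*(X)/I$ is completely isometric on $X$, i.e. $\inf\{\|[x_{ij}+y_{ij}]\| : y_{ij}\in I\}=\|[x_{ij}]\|$ for every $\nu$ and every $[x_{ij}]\in M_\nu(X)$; the biggest boundary ideal is called the Šilov ideal of $X$ in $C^*(X)$. For a ucc map $\phi\colon C^*(X)\to B(H)$ with $\phi(x)=x$ for all $x\in X$, let $$P_\phi=\{\phi(c)-c \;:\; c\in C^*(X),\ \phi(c)-c\in C^*(X)\}.$$ Then the Šilov ideal of $X$ in $C^*(X)$ exists, and the union of the sets $P_\phi$, over all ucc maps $\phi\colon C^*(X)\to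 B(H)$ with $\phi|_X=\mathrm{id}_X$, is equal to the Šilov ideal. In particular, this union is closed. -/

import Mathlib

namespace OperatorSpace

variable {H : Type*} [NormedAddCommGroup H] [InnerProductSpace ℂ H] [CompleteSpace H]

/-- The unital C⋆-algebra `C*(X) ⊆ B(H)` generated by a subspace `X` of `B(H)`. -/
noncomputable def cstar (X : Submodule ℂ (H →L[ℂ] H)) : StarSubalgebra ℂ (H →L[ℂ] H) :=
  (StarAlgebra.adjoin ℂ (X : Set (H →L[ℂ] H))).topologicalClosure

/-- The norm of a matrix over a C⋆-subalgebra `C ⊆ B(H)`: the C⋆-norm of `M_n(B(H)) ≅ B(Hⁿ)`. -/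
noncomputable def matNorm {C : StarSubalgebra ℂ (H →L[ℂ] H)} {n : ℕ}
    (M : CStarMatrix (Fin n) (Fin n) C) : ℝ :=
  ‖(M.map (fun c => (c : H →L[ℂ] H)) : CStarMatrix (Fin n) (Fin n) (H →L[ℂ] H))‖

/-- Unital completely contractive maps `C → B(H)`. -/
structure IsUCC {C : StarSubalgebra ℂ (H →L[ℂ] H)} (φ : C →ₗ[ℂ] (H →L[ℂ] H)) : Prop where
  map_one : φ 1 = 1
  norm_map_le : ∀ (n : ℕ) (M : CStarMatrix (Fin n) (Fin n) C), ‖M.map φ‖ ≤ matNorm M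

/-- The ucc maps `φ : C*(X) → B(H)` that extend the identity map of `X`. -/
def extId (X : Submodule ℂ (H →L[ℂ] H)) : Set (cstar X →ₗ[ℂ] (H →L[ℂ] H)) :=
  {φ | IsUCC φ ∧ ∀ c : cstar X, (c : H →L[ℂ] H) ∈ X → φ c = c}

/-- The set `P_φ` of abnormalities: the elements of `C*(X)` of the form `φ(c) - c`, `c ∈ C*(X)`. -/
def abnormalities {X : Submodule ℂ (H →L[ℂ] H)} (φ : cstar X →ₗ[ℂ] (H →L[ℂ] H)) :
    Set (cstar X) :=
  {a | ∃ c : cstar X, (a : H →L[ℂ] H) = φ c - c}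

/-- The norm of the class of `M` in `M_n(C / I) = M_n(C) / M_n(I)`, that is, the infimum of
`‖M + Y‖` over the matrices `Y` with entries in `I`. -/
noncomputable def quotientMatNorm {C : StarSubalgebra ℂ (H →L[ℂ] H)} (I : TwoSidedIdeal C)
    {n : ℕ} (M : CStarMatrix (Fin n) (Fin n) C) : ℝ :=
  ⨅ Y : {Y : CStarMatrix (Fin n) (Fin n) C // ∀ i j, Y i j ∈ I}, matNorm (M + Y.1)

/-- A closed two-sided ideal `I` of `C*(X)` is boundary if the quotient map `C*(X) → C*(X) / I`
(which is always unital) is completely isometric on `X`. -/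
structure IsBoundaryIdeal (X : Submodule ℂ (H →L[ℂ] H)) (I : TwoSidedIdeal (cstar X)) : Prop where
  isClosed : IsClosed (I : Set (cstar X))
  completelyIsometric : ∀ (n : ℕ) (M : CStarMatrix (Fin n) (Fin n) (cstar X)),
    (∀ i j, (M i j : H →L[ℂ] H) ∈ X) → quotientMatNorm I M = matNorm M

/-- The Šilov ideal of `X` in `C*(X)`: the biggest boundary ideal. -/
def IsSilovIdeal (X : Submodule ℂ (H →L[ℂ] H)) (I : TwoSidedIdeal (cstar X)) : Prop :=
  IsGreatest {J : TwoSidedIdeal (cstar X) | IsBoundaryIdeal X J} I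

end OperatorSpace

open scoped ComplexOrder InnerProductSpace

namespace OperatorSpace

open Filter Topology

/-! The Šilov ideal is the kernel on `C*(X)` of a rigid map: a completely contractive `E` on `B(H)`
that fixes `X` and satisfies `E ∘ Ψ ∘ E = E` for every such `Ψ`. To find `E`, Zorn's lemma and
point-weak compactness give a minimal seminorm `a ↦ ‖E a‖`. The Cesàro averages of the powers of `Ψ
∘ E` cluster at a map with no larger seminorm that kills `a - Ψ (E a)`; by minimality `E` kills it
too (`exists_minimal`). By the Choi-Effros identity, `ker E` is stable under multiplication by
`C*(X)`, so it cuts out an ideal there. The same identity, with the fact that idempotents with one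
range induce one product on it, yields the central fact `IsRigid.apply_apply`: `E ∘ Ψ = E` on
`C*(X)`. The rest uses Arveson's extension theorem. For a boundary ideal `J`, the map `x + y ↦ x` on
`X + J` extends to some `Ψ` that fixes `X` and kills `J`, so `E = E ∘ Ψ` kills `J`. A ucc `φ`
extends to some `Ψ`, so `E (φ c - c) = 0`. Conversely, if `E a = 0`, then `a = E (-a) - (-a)` is an
abnormality of `E` itself. -/

/-! ### Positive functionals on a C⋆-algebra. -/

/-- A functional on a unital C⋆-algebra that attains its norm at the unit is positive. -/
theorem functional_nonneg {A : Type*} [CStarAlgebra A] [PartialOrder A] [StarOrderedRing A]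
    (f : A →ₗ[ℂ] ℂ) {r : ℝ} (hf : ∀ a, ‖f a‖ ≤ r * ‖a‖) (h1 : f 1 = r) {a : A} (ha : 0 ≤ a) :
    0 ≤ f a := by
  rcases subsingleton_or_nontrivial A with _ | _
  · rw [Subsingleton.elim a 0, map_zero]
  have hr : 0 ≤ r := by
    have := hf 1
    rw [norm_one, mul_one] at this
    exact (norm_nonneg _).trans this
  have hsa : IsSelfAdjoint a := .of_nonneg ha
  -- Test `f` on `a + it`. The terms `t² r²` on the two sides cancel, which leaves an expression
  -- linear in `t` that is bounded above; this forces `Im f(a) = 0`.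
  have him : ∀ t : ℝ, ((f a).im + t * r) ^ 2 ≤ r ^ 2 * (‖a‖ ^ 2 + t ^ 2) := by
    intro t
    set c : A := a + (Complex.I * t) • (1 : A) with hc
    have hfc : (f c).im = (f a).im + t * r := by
      simp [hc, h1]
    have hcc : ‖c‖ ^ 2 ≤ ‖a‖ ^ 2 + t ^ 2 := by
      rw [sq, ← CStarRing.norm_star_mul_self]
      have : star c * c = star a * a + ((t : ℂ) ^ 2) • (1 : A) := by
        rw [hc, hsa.star_eq]
        simp only [star_add, hsa.star_eq, star_smul, star_one, add_mul, mul_add, smul_mul_assoc,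
          mul_smul_comm, one_mul, mul_one, smul_smul, smul_add]
        have : star (Complex.I * t) = - (Complex.I * t) := by simp
        have h2 : Complex.I * t * -(Complex.I * t) = (t : ℂ) ^ 2 := by
          linear_combination (- (t : ℂ) ^ 2) * Complex.I_mul_I
        rw [this, h2]
        module
      rw [this]
      refine (norm_add_le _ _).trans ?_
      rw [CStarRing.norm_star_mul_self, norm_smul, norm_one]
      simp [sq]
    have h2 := hf c
    have h3 : |(f c).im| ≤ r * ‖c‖ := (Complex.abs_im_le_norm _).trans h2
    rw [← hfc]
    calc (f c).im ^ 2 = |(f c).im| ^ 2 := (sq_abs _).symm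
      _ ≤ (r * ‖c‖) ^ 2 := by gcongr
      _ = r ^ 2 * ‖c‖ ^ 2 := by ring
      _ ≤ _ := by gcongr
  have him0 : (f a).im = 0 := by
    rcases hr.eq_or_lt with h0 | h0
    · have := hf a
      rw [← h0, zero_mul] at this
      rw [norm_le_zero_iff.mp this]; simp
    · by_contra hne
      have h4 : ∀ t : ℝ, 2 * t * r * (f a).im ≤ r ^ 2 * ‖a‖ ^ 2 := by
        intro t
        nlinarith [him t, sq_nonneg (f a).im]
      have h5 := h4 ((r ^ 2 * ‖a‖ ^ 2 + 1) / (2 * r * (f a).im))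
      have : 2 * ((r ^ 2 * ‖a‖ ^ 2 + 1) / (2 * r * (f a).im)) * r * (f a).im
          = r ^ 2 * ‖a‖ ^ 2 + 1 := by
        field_simp
      linarith
  have hre : 0 ≤ (f a).re := by
    have h2 : ‖algebraMap ℝ A ‖a‖ - a‖ ≤ ‖a‖ := by
      have h3 : a ≤ algebraMap ℝ A ‖a‖ := hsa.le_algebraMap_norm_self
      refine (CStarAlgebra.norm_le_norm_of_nonneg_of_le (sub_nonneg.mpr h3)
        (sub_le_self _ ha)).trans ?_
      simp
    have h3 := (hf _).trans (mul_le_mul_of_nonneg_left h2 hr)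
    have h4 : (f (algebraMap ℝ A ‖a‖ - a)).re = r * ‖a‖ - (f a).re := by
      rw [Algebra.algebraMap_eq_smul_one, ← Complex.coe_smul, map_sub, map_smul, h1]
      simp [mul_comm]
    have h5 := (Complex.re_le_norm _).trans h3
    linarith
  exact Complex.nonneg_iff.mpr ⟨hre, him0.symm⟩

theorem exists_star_mul_self_eq_norm_sq_sub {A : Type*} [CStarAlgebra A] [PartialOrder A]
    [StarOrderedRing A] (a : A) :
    ∃ b : A, star b * b = ((‖a‖ ^ 2 : ℝ) : ℂ) • 1 - star a * a := by
  obtain ⟨b, hb⟩ := CStarAlgebra.nonneg_iff_eq_star_mul_self.mp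
    (sub_nonneg.mpr (CStarAlgebra.star_mul_le_algebraMap_norm_sq (a := a)))
  refine ⟨b, ?_⟩
  rw [← hb, Algebra.algebraMap_eq_smul_one, ← Complex.coe_smul]

/-! ### Operator matrices as sesquilinear forms on tuples of vectors. -/

/-- The norm of a tuple of vectors in the Hilbert space sum. -/
noncomputable def tupleNorm {H : Type*} [NormedAddCommGroup H] {ι : Type*} [Fintype ι]
    (ξ : ι → H) : ℝ :=
  √(∑ i, ‖ξ i‖ ^ 2)

section Tuple

variable {H : Type*} [NormedAddCommGroup H] {ι : Type*} [Fintype ι]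

theorem tupleNorm_nonneg (ξ : ι → H) : 0 ≤ tupleNorm ξ :=
  Real.sqrt_nonneg _

theorem sq_tupleNorm (ξ : ι → H) : tupleNorm ξ ^ 2 = ∑ i, ‖ξ i‖ ^ 2 :=
  Real.sq_sqrt (Finset.sum_nonneg fun _ _ => by positivity)

end Tuple

variable {H : Type*} [NormedAddCommGroup H] [InnerProductSpace ℂ H]

/-- The value `⟨η, M ξ⟩` of a matrix of operators at two tuples of vectors. -/
noncomputable def matForm {ι κ : Type*} [Fintype ι] [Fintype κ] (M : ι → κ → H →L[ℂ] H)
    (ξ : κ → H) (η : ι → H) : ℂ :=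
  ∑ i, ∑ j, ⟪η i, M i j (ξ j)⟫_ℂ

theorem opNorm_le_of_inner_le (T : H →L[ℂ] H) {C : ℝ} (hC : 0 ≤ C)
    (h : ∀ ξ η, ‖⟪η, T ξ⟫_ℂ‖ ≤ C * ‖ξ‖ * ‖η‖) : ‖T‖ ≤ C := by
  refine T.opNorm_le_bound hC fun ξ => ?_
  rcases (norm_nonneg (T ξ)).eq_or_lt with h0 | h0
  · rw [← h0]; positivity
  · refine le_of_mul_le_mul_right ?_ h0
    have h1 := h ξ (T ξ)
    rwa [inner_self_eq_norm_sq_to_K, norm_pow, RCLike.norm_ofReal, abs_norm, sq] at h1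

theorem nonneg_iff_inner_nonneg {T : H →L[ℂ] H} : 0 ≤ T ↔ ∀ ξ, 0 ≤ ⟪ξ, T ξ⟫_ℂ := by
  rw [ContinuousLinearMap.nonneg_iff_isPositive]
  refine ⟨fun h ξ => h.inner_nonneg_right ξ, fun h => ?_⟩
  rw [ContinuousLinearMap.isPositive_iff_complex]
  intro ξ
  obtain ⟨h1, h2⟩ := Complex.nonneg_iff.mp (h ξ)
  have h3 : ⟪T ξ, ξ⟫_ℂ = ⟪ξ, T ξ⟫_ℂ := by
    rw [← inner_conj_symm, Complex.conj_eq_iff_im, ← h2]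
  rw [h3]
  exact ⟨Complex.ext rfl (by simpa using h2), h1⟩

variable [CompleteSpace H]

theorem tupleNorm_star_apply_le {ι : Type*} [Fintype ι] (v : ι → H →L[ℂ] H) (ξ : H) :
    tupleNorm (fun i => star (v i) ξ) ≤ √‖∑ i, v i * star (v i)‖ * ‖ξ‖ := by
  refine Real.sqrt_le_iff.mpr ⟨by positivity, ?_⟩
  have h1 : ((∑ i, ‖star (v i) ξ‖ ^ 2 : ℝ) : ℂ) = ⟪ξ, (∑ i, v i * star (v i)) ξ⟫_ℂ := by
    rw [sum_apply, inner_sum]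
    push_cast
    refine Finset.sum_congr rfl fun i _ => ?_
    change _ = ⟪ξ, v i (star (v i) ξ)⟫_ℂ
    rw [← ContinuousLinearMap.adjoint_inner_left,
      ← ContinuousLinearMap.star_eq_adjoint, inner_self_eq_norm_sq_to_K]
    simp
  have h3 : (∑ i, ‖star (v i) ξ‖ ^ 2 : ℝ) = ‖⟪ξ, (∑ i, v i * star (v i)) ξ⟫_ℂ‖ := by
    rw [← h1, Complex.norm_real, Real.norm_of_nonneg]
    exact Finset.sum_nonneg fun _ _ => by positivity
  rw [h3, mul_pow, Real.sq_sqrt (norm_nonneg _)]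
  refine (norm_inner_le_norm _ _).trans ?_
  calc _ ≤ ‖ξ‖ * (‖∑ i, v i * star (v i)‖ * ‖ξ‖) := by
        gcongr; exact ContinuousLinearMap.le_opNorm _ _
    _ = _ := by ring

-- The norm of `CStarMatrix` is defined by the action on a C⋆-module over `B(H)`. Evaluating the
-- module inner product at `ξ` and `η` turns it into the form at the tuples `star (w j) ξ` and `star
-- (v i) η`, so the norm is controlled by the action on `Hⁿ`.
open WithCStarModule in
theorem norm_le_of_matForm_le {n : ℕ} (M : CStarMatrix (Fin n) (Fin n) (H →L[ℂ] H)) {C : ℝ}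
    (hC : 0 ≤ C)
    (h : ∀ ξ η : Fin n → H, ‖matForm M ξ η‖ ≤ C * tupleNorm ξ * tupleNorm η) : ‖M‖ ≤ C := by
  lift C to NNReal using hC
  refine CStarMatrix.norm_le_of_forall_inner_le fun v w => ?_
  obtain ⟨v, rfl⟩ := (equiv (H →L[ℂ] H) (Fin n → H →L[ℂ] H)).symm.surjective v
  obtain ⟨w, rfl⟩ := (equiv (H →L[ℂ] H) (Fin n → H →L[ℂ] H)).symm.surjective w
  have hn : ∀ v : Fin n → H →L[ℂ] H,
      ‖(equiv (H →L[ℂ] H) (Fin n → H →L[ℂ] H)).symm v‖ = √‖∑ i, v i * star (v i)‖ := fun v => by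
    rw [pi_norm]; rfl
  have hin : inner (H →L[ℂ] H) ((equiv (H →L[ℂ] H) (Fin n → H →L[ℂ] H)).symm w)
      (CStarMatrix.toCLM M ((equiv (H →L[ℂ] H) (Fin n → H →L[ℂ] H)).symm v))
      = ∑ j, (∑ i, v i * M i j) * star (w j) := by
    rw [CStarMatrix.toCLM_apply_eq_sum]; rfl
  rw [hin, hn, hn]
  refine opNorm_le_of_inner_le _ (by positivity) fun ξ η => ?_
  have : ⟪η, (∑ j, (∑ i, v i * M i j) * star (w j)) ξ⟫_ℂ
      = matForm M (fun j => star (w j) ξ) (fun i => star (v i) η) := by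
    simp only [sum_apply, inner_sum, mul_apply_eq_comp, matForm,
      ContinuousLinearMap.star_eq_adjoint, ContinuousLinearMap.adjoint_inner_left]
    rw [Finset.sum_comm]
  rw [this]
  refine (h _ _).trans ?_
  calc _ ≤ C * (√‖∑ i, w i * star (w i)‖ * ‖ξ‖) * (√‖∑ i, v i * star (v i)‖ * ‖η‖) := by
        gcongr
        · exact tupleNorm_nonneg _
        · exact tupleNorm_star_apply_le w ξ
        · exact tupleNorm_star_apply_le v η
    _ = _ := by ring

/-! ### Completely positive maps are completely contractive. -/

/-- Complete positivity of a linear map on `B(H)`, in terms of vectors. -/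
def IsCP (Φ : (H →L[ℂ] H) →ₗ[ℂ] (H →L[ℂ] H)) : Prop :=
  ∀ (ι : Type) [Fintype ι] (a : ι → H →L[ℂ] H) (ξ : ι → H),
    0 ≤ matForm (fun i j => Φ (star (a i) * a j)) ξ ξ

theorem isCP_id : IsCP (LinearMap.id : (H →L[ℂ] H) →ₗ[ℂ] (H →L[ℂ] H)) := by
  intro ι _ a ξ
  have : matForm (fun i j => (LinearMap.id : (H →L[ℂ] H) →ₗ[ℂ] _) (star (a i) * a j)) ξ ξ
      = ⟪∑ i, a i (ξ i), ∑ i, a i (ξ i)⟫_ℂ := by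
    simp only [matForm, LinearMap.id_coe, id, mul_apply_eq_comp,
      ContinuousLinearMap.star_eq_adjoint, ContinuousLinearMap.adjoint_inner_right, sum_inner,
      inner_sum]
    exact Finset.sum_comm
  rw [this, inner_self_eq_norm_sq_to_K]
  norm_cast
  positivity

theorem apply_star_of_nonneg {Φ : (H →L[ℂ] H) →ₗ[ℂ] (H →L[ℂ] H)} (h : ∀ b, 0 ≤ b → 0 ≤ Φ b)
    (a : H →L[ℂ] H) : Φ (star a) = star (Φ a) :=
  StarHomClass.map_star (PositiveLinearMap.mk₀ Φ h) a

theorem IsCP.apply_nonneg {Φ : (H →L[ℂ] H) →ₗ[ℂ] (H →L[ℂ] H)} (h : IsCP Φ) {b : H →L[ℂ] H}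
    (hb : 0 ≤ b) : 0 ≤ Φ b := by
  obtain ⟨c, rfl⟩ := CStarAlgebra.nonneg_iff_eq_star_mul_self.mp hb
  rw [nonneg_iff_inner_nonneg]
  intro ξ
  simpa [matForm] using h Unit (fun _ => c) (fun _ => ξ)

/-- A Cauchy-Schwarz argument: positivity at a tuple with `t η` adjoined gives a nonnegative
quadratic polynomial in `t`, and its discriminant is the bound. -/
theorem IsCP.norm_matForm_le {Φ : (H →L[ℂ] H) →ₗ[ℂ] (H →L[ℂ] H)} (h : IsCP Φ)
    (h1 : ∀ ξ, (⟪ξ, Φ 1 ξ⟫_ℂ).re ≤ ‖ξ‖ ^ 2) {n : ℕ}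
    (M : CStarMatrix (Fin n) (Fin n) (H →L[ℂ] H)) (ξ η : Fin n → H) :
    ‖matForm (M.map Φ) ξ η‖ ≤ ‖M‖ * tupleNorm ξ * tupleNorm η := by
  have hsq : ∀ ξ : Fin n → H, (matForm (fun i j => Φ ((star M * M) i j)) ξ ξ).re
      ≤ ‖M‖ ^ 2 * tupleNorm ξ ^ 2 := by
    intro ξ
    -- Apply positivity to `N⋆N = ‖M‖² - M⋆M`, split into the contributions of the rows of `N`.
    obtain ⟨N, hN⟩ := exists_star_mul_self_eq_norm_sq_sub M
    have h2 : 0 ≤ matForm (fun i j => Φ ((star N * N) i j)) ξ ξ := by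
      have : matForm (fun i j => Φ ((star N * N) i j)) ξ ξ
          = ∑ k, matForm (fun i j => Φ (star (N k i) * N k j)) ξ ξ := by
        simp only [matForm, CStarMatrix.mul_apply, CStarMatrix.star_apply, map_sum, sum_apply,
          inner_sum]
        rw [Finset.sum_comm' (t' := Finset.univ) (s' := fun _ => Finset.univ) (by simp)]
        rw [eq_comm, Finset.sum_comm]
        rw [eq_comm, Finset.sum_comm]
        refine Finset.sum_congr rfl fun i _ => ?_
        rw [Finset.sum_comm]
      rw [this]
      exact Finset.sum_nonneg fun k _ => h _ _ _
    have h3 : ∀ i j, Φ ((star N * N) i j)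
        = (if i = j then ((‖M‖ ^ 2 : ℝ) : ℂ) • Φ 1 else 0) - Φ ((star M * M) i j) := by
      intro i j
      rw [hN, CStarMatrix.sub_apply, map_sub, CStarMatrix.smul_apply, CStarMatrix.one_apply]
      split_ifs <;> simp
    have h4 : matForm (fun i j => Φ ((star N * N) i j)) ξ ξ
        = ((‖M‖ ^ 2 : ℝ) : ℂ) * (∑ i, ⟪ξ i, Φ 1 (ξ i)⟫_ℂ)
          - matForm (fun i j => Φ ((star M * M) i j)) ξ ξ := by
      simp only [matForm, h3, sub_apply, inner_sub_right, Finset.sum_sub_distrib]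
      congr 1
      rw [Finset.mul_sum]
      refine Finset.sum_congr rfl fun i _ => ?_
      rw [Finset.sum_eq_single i (by intro j _ hj; rw [if_neg hj.symm]; simp) (by simp)]
      simp [inner_smul_right]
    rw [h4] at h2
    have h5 := (Complex.nonneg_iff.mp h2).1
    rw [Complex.sub_re, Complex.re_ofReal_mul, Complex.re_sum] at h5
    have h6 : ∑ i, (⟪ξ i, Φ 1 (ξ i)⟫_ℂ).re ≤ tupleNorm ξ ^ 2 := by
      rw [sq_tupleNorm]
      exact Finset.sum_le_sum fun i _ => h1 _
    nlinarith [sq_nonneg ‖M‖]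
  have hre : ∀ ξ : Fin n → H,
      |(matForm (M.map Φ) ξ η).re| ≤ ‖M‖ * tupleNorm ξ * tupleNorm η := by
    intro ξ
    have hquad : ∀ t : ℝ, 0 ≤ tupleNorm η ^ 2 * (t * t) + 2 * (matForm (M.map Φ) ξ η).re * t
        + ‖M‖ ^ 2 * tupleNorm ξ ^ 2 := by
      intro t
      have h2 : ∀ k, 0 ≤ (∑ i, ∑ j, ⟪ξ i, Φ (star (M k i) * M k j) (ξ j)⟫_ℂ)
          + ((t : ℂ) * (∑ j, ⟪η k, Φ (M k j) (ξ j)⟫_ℂ)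
            + (t : ℂ) * (∑ j, ⟪ξ j, Φ (star (M k j)) (η k)⟫_ℂ))
          + (t : ℂ) * t * ⟪η k, Φ 1 (η k)⟫_ℂ := by
        intro k
        -- The `k`-th row of `M` with the operator `1` adjoined, and the tuple `ξ` with `t η k`
        -- adjoined.
        have := h (Option (Fin n)) (fun o => o.elim 1 (M k)) (fun o => o.elim ((t : ℂ) • η k) ξ)
        simp only [matForm, Fintype.sum_option, Option.elim, star_one, one_mul, mul_one, map_smul,
          inner_smul_left, inner_smul_right, Complex.conj_ofReal, Finset.sum_add_distrib,
          ← Finset.mul_sum] at this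
        convert this using 1
        ring
      have h3 : ∀ k, (∑ j, ⟪ξ j, Φ (star (M k j)) (η k)⟫_ℂ).re
          = (∑ j, ⟪η k, Φ (M k j) (ξ j)⟫_ℂ).re := by
        intro k
        rw [Complex.re_sum, Complex.re_sum]
        refine Finset.sum_congr rfl fun j _ => ?_
        rw [apply_star_of_nonneg fun _ => h.apply_nonneg, ContinuousLinearMap.star_eq_adjoint,
          ContinuousLinearMap.adjoint_inner_right, ← inner_conj_symm, Complex.conj_re]
      have h4 := Finset.sum_nonneg fun k (_ : k ∈ Finset.univ) => (Complex.nonneg_iff.mp (h2 k)).1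
      simp only [Complex.add_re, h3, Complex.re_ofReal_mul, ← Complex.ofReal_mul,
        Finset.sum_add_distrib, ← Finset.mul_sum] at h4
      have h5 : ∑ k, (⟪η k, Φ 1 (η k)⟫_ℂ).re ≤ tupleNorm η ^ 2 := by
        rw [sq_tupleNorm]
        exact Finset.sum_le_sum fun i _ => h1 _
      have h6 : ∑ k, (∑ i, ∑ j, ⟪ξ i, Φ (star (M k i) * M k j) (ξ j)⟫_ℂ).re
          = (matForm (fun i j => Φ ((star M * M) i j)) ξ ξ).re := by
        rw [← Complex.re_sum]
        congr 1
        simp only [matForm, CStarMatrix.mul_apply, CStarMatrix.star_apply, map_sum, sum_apply,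
          inner_sum]
        rw [Finset.sum_comm]
        refine Finset.sum_congr rfl fun i _ => ?_
        rw [Finset.sum_comm]
      have h7 : ∑ k, (∑ j, ⟪η k, Φ (M k j) (ξ j)⟫_ℂ).re = (matForm (M.map Φ) ξ η).re := by
        rw [← Complex.re_sum]; rfl
      rw [h6, h7] at h4
      have h8 := hsq ξ
      nlinarith [mul_self_nonneg t]
    have h9 := discrim_le_zero hquad
    rw [discrim] at h9
    have h10 : 0 ≤ ‖M‖ * tupleNorm ξ * tupleNorm η :=
      mul_nonneg (mul_nonneg (norm_nonneg _) (tupleNorm_nonneg _)) (tupleNorm_nonneg _)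
    refine abs_le_of_sq_le_sq ?_ h10
    nlinarith
  obtain ⟨c, hc, hc2⟩ : ∃ c : ℂ, ‖c‖ = 1 ∧ c * matForm (M.map Φ) ξ η
      = ‖matForm (M.map Φ) ξ η‖ := by
    obtain ⟨c, hc, hc2⟩ := RCLike.exists_norm_eq_mul_self (matForm (M.map Φ) ξ η)
    exact ⟨c, hc, hc2.symm⟩
  -- Rotating `ξ` by a phase upgrades the bound on the real part to one on the modulus.
  have h2 := hre (fun i => c • ξ i)
  have h3 : matForm (M.map Φ) (fun i => c • ξ i) η = c * matForm (M.map Φ) ξ η := by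
    simp only [matForm, map_smul, inner_smul_right, Finset.mul_sum]
  have h4 : tupleNorm (fun i => c • ξ i) = tupleNorm ξ := by
    simp only [tupleNorm, norm_smul, hc, one_mul]
  rw [h3, h4, hc2, Complex.ofReal_re, abs_norm] at h2
  exact h2

theorem norm_matForm_le {n : ℕ} (M : CStarMatrix (Fin n) (Fin n) (H →L[ℂ] H)) (ξ η : Fin n → H) :
    ‖matForm M ξ η‖ ≤ ‖M‖ * tupleNorm ξ * tupleNorm η :=
  isCP_id.norm_matForm_le (fun ξ => by
    simp only [LinearMap.id_coe, id, one_apply_eq_self]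
    rw [inner_self_eq_norm_sq_to_K]
    norm_cast) M ξ η

/-! ### Point-weak compactness and Arveson's extension theorem. -/

/-- Hahn-Banach for a functional on a space that is mapped linearly to a normed space. -/
theorem exists_functional_extension {E W : Type*} [NormedAddCommGroup E] [NormedSpace ℂ E]
    [AddCommGroup W] [Module ℂ W] (p : W →ₗ[ℂ] E) (s : W →ₗ[ℂ] ℂ) {C : ℝ} (hC : 0 ≤ C)
    (h : ∀ w, ‖s w‖ ≤ C * ‖p w‖) :
    ∃ S : E →ₗ[ℂ] ℂ, (∀ w, S (p w) = s w) ∧ ∀ x, ‖S x‖ ≤ C * ‖x‖ := by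
  have hker : LinearMap.ker p ≤ LinearMap.ker s := by
    intro w hw
    have := h w
    rw [LinearMap.mem_ker.mp hw, norm_zero, mul_zero] at this
    exact norm_le_zero_iff.mp this
  let g : LinearMap.range p →ₗ[ℂ] ℂ :=
    (LinearMap.ker p).liftQ s hker ∘ₗ p.quotKerEquivRange.symm.toLinearMap
  have hg : ∀ w, g ⟨p w, LinearMap.mem_range_self p w⟩ = s w := by
    intro w
    simp only [g, LinearMap.comp_apply, LinearEquiv.coe_coe]
    have : p.quotKerEquivRange.symm ⟨p w, LinearMap.mem_range_self p w⟩
        = (LinearMap.ker p).mkQ w := p.quotKerEquivRange_symm_apply_image w _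
    rw [this]; simp
  have hgn : ∀ x, ‖g x‖ ≤ C * ‖x‖ := by
    rintro ⟨_, w, rfl⟩
    rw [hg]; exact h w
  obtain ⟨S, hS, hSn⟩ := exists_extension_norm_eq (LinearMap.range p) (g.mkContinuous C hgn)
  refine ⟨S, fun w => ?_, fun x => ?_⟩
  · rw [← hg]; exact hS ⟨p w, LinearMap.mem_range_self p w⟩
  · refine (S.le_opNorm x).trans ?_
    gcongr
    rw [hSn]
    exact LinearMap.mkContinuous_norm_le _ hC _

/-- Completely contractive linear maps on `B(H)`. -/
def IsCC (Φ : (H →L[ℂ] H) →ₗ[ℂ] (H →L[ℂ] H)) : Prop :=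
  ∀ (n : ℕ) (M : CStarMatrix (Fin n) (Fin n) (H →L[ℂ] H)), ‖M.map Φ‖ ≤ ‖M‖

theorem IsCC.norm_matForm_le {Φ : (H →L[ℂ] H) →ₗ[ℂ] (H →L[ℂ] H)} (h : IsCC Φ) {n : ℕ}
    (M : CStarMatrix (Fin n) (Fin n) (H →L[ℂ] H)) (ξ η : Fin n → H) :
    ‖matForm (M.map Φ) ξ η‖ ≤ ‖M‖ * tupleNorm ξ * tupleNorm η := by
  refine (OperatorSpace.norm_matForm_le _ ξ η).trans ?_
  gcongr
  · exact tupleNorm_nonneg _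
  · exact tupleNorm_nonneg _
  · exact h n M

theorem norm_fin_one (a : H →L[ℂ] H) :
    ‖(CStarMatrix.ofMatrix fun _ _ => a : CStarMatrix (Fin 1) (Fin 1) (H →L[ℂ] H))‖ = ‖a‖ := by
  refine le_antisymm (norm_le_of_matForm_le _ (norm_nonneg _) fun ξ η => ?_) ?_
  · simp only [matForm, tupleNorm, Finset.univ_unique, Finset.sum_singleton,
      Real.sqrt_sq (norm_nonneg _)]
    refine (norm_inner_le_norm _ _).trans ?_
    rw [mul_comm]
    gcongr
    exact a.le_opNorm _
  · exact CStarMatrix.norm_entry_le_norm (i := 0) (j := 0)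
      (M := (CStarMatrix.ofMatrix fun _ _ => a : CStarMatrix (Fin 1) (Fin 1) (H →L[ℂ] H)))

theorem IsCC.norm_apply_le {Φ : (H →L[ℂ] H) →ₗ[ℂ] (H →L[ℂ] H)} (h : IsCC Φ) (a : H →L[ℂ] H) :
    ‖Φ a‖ ≤ ‖a‖ := by
  rw [← norm_fin_one a, ← norm_fin_one (Φ a)]
  exact h 1 _

/-- Weak operator compactness of balls: the limits of the matrix coefficients exist in compact discs
and form a bounded sesquilinear form, which an operator represents. -/
theorem exists_tendsto_inner {ι : Type*} (𝒰 : Ultrafilter ι) (T : ι → H →L[ℂ] H) {C : ℝ}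
    (hT : ∀ i, ‖T i‖ ≤ C) :
    ∃ S : H →L[ℂ] H, ∀ ξ η, Tendsto (fun i => ⟪η, T i ξ⟫_ℂ) 𝒰 (𝓝 ⟪η, S ξ⟫_ℂ) := by
  have hex : ∀ ξ η, ∃ l : ℂ, ‖l‖ ≤ C * ‖ξ‖ * ‖η‖ ∧
      Tendsto (fun i => ⟪T i ξ, η⟫_ℂ) 𝒰 (𝓝 l) := by
    intro ξ η
    have hle : ∀ i, ‖⟪T i ξ, η⟫_ℂ‖ ≤ C * ‖ξ‖ * ‖η‖ := fun i =>
      (norm_inner_le_norm _ _).trans (by gcongr; exact (T i).le_of_opNorm_le (hT i) ξ)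
    obtain ⟨l, hl, hl2⟩ := (isCompact_closedBall (0 : ℂ) (C * ‖ξ‖ * ‖η‖)).ultrafilter_le_nhds
      (𝒰.map fun i => ⟪T i ξ, η⟫_ℂ) (by
        rw [le_principal_iff]
        exact Filter.mem_map.mpr (Filter.univ_mem' fun i => by simpa using hle i))
    exact ⟨l, by simpa using hl, hl2⟩
  choose l hl hlim using hex
  let L : H →ₗ⋆[ℂ] H →ₗ[ℂ] ℂ := LinearMap.mk₂'ₛₗ (starRingEnd ℂ) (RingHom.id ℂ) l
    (fun x y z => tendsto_nhds_unique (hlim _ _)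
      (by simpa only [map_add, inner_add_left] using (hlim x z).add (hlim y z)))
    (fun c x z => tendsto_nhds_unique (hlim _ _)
      (by simpa only [map_smul, inner_smul_left, smul_eq_mul] using (hlim x z).const_mul _))
    (fun x y z => tendsto_nhds_unique (hlim _ _)
      (by simpa only [inner_add_right] using (hlim x y).add (hlim x z)))
    (fun c x z => tendsto_nhds_unique (hlim _ _)
      (by simpa only [inner_smul_right, smul_eq_mul, RingHom.id_apply] using (hlim x z).const_mul _))
  let L' : H →L⋆[ℂ] H →L[ℂ] ℂ := L.mkContinuous₂ C hl
  refine ⟨InnerProductSpace.continuousLinearMapOfBilin L', fun ξ η => ?_⟩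
  have h1 := (Complex.continuous_conj.tendsto _).comp (hlim ξ η)
  have h2 : ⟪InnerProductSpace.continuousLinearMapOfBilin L' ξ, η⟫_ℂ = l ξ η :=
    InnerProductSpace.continuousLinearMapOfBilin_apply L' ξ η
  rw [← inner_conj_symm, h2]
  refine h1.congr fun i => ?_
  simp

/-- Completely contractive maps on `B(H)` have cluster points for the point-weak topology. -/
theorem exists_ultralimit {ι : Type*} (𝒰 : Ultrafilter ι)
    (Φ : ι → (H →L[ℂ] H) →ₗ[ℂ] (H →L[ℂ] H)) (hΦ : ∀ i, IsCC (Φ i)) :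
    ∃ Ψ : (H →L[ℂ] H) →ₗ[ℂ] (H →L[ℂ] H), IsCC Ψ ∧
      ∀ a ξ η, Tendsto (fun i => ⟪η, Φ i a ξ⟫_ℂ) 𝒰 (𝓝 ⟪η, Ψ a ξ⟫_ℂ) := by
  choose T hT using fun a => exists_tendsto_inner 𝒰 (fun i => Φ i a)
    (fun i => (hΦ i).norm_apply_le a)
  let Ψ : (H →L[ℂ] H) →ₗ[ℂ] (H →L[ℂ] H) :=
    { toFun := T
      map_add' := fun a b => by
        ext ξ
        refine ext_inner_left ℂ fun η => tendsto_nhds_unique (hT _ ξ η) ?_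
        simpa only [map_add, add_apply, inner_add_right] using (hT a ξ η).add (hT b ξ η)
      map_smul' := fun c a => by
        ext ξ
        refine ext_inner_left ℂ fun η => tendsto_nhds_unique (hT _ ξ η) ?_
        simpa only [map_smul, smul_apply, inner_smul_right, RingHom.id_apply]
          using (hT a ξ η).const_mul c }
  refine ⟨Ψ, fun n M => norm_le_of_matForm_le _ (norm_nonneg _) fun ξ η => ?_, hT⟩
  have hlim : Tendsto (fun i => matForm (M.map (Φ i)) ξ η) 𝒰 (𝓝 (matForm (M.map Ψ) ξ η)) :=
    tendsto_finsetSum _ fun i _ => tendsto_finsetSum _ fun j _ => hT _ _ _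
  exact le_of_tendsto hlim.norm (Eventually.of_forall fun i => (hΦ i).norm_matForm_le M ξ η)

/-- The matrix with a single nonzero entry, as a linear function of the entry. -/
def singleₗ {n : ℕ} (i j : Fin n) :
    (H →L[ℂ] H) →ₗ[ℂ] CStarMatrix (Fin n) (Fin n) (H →L[ℂ] H) :=
  (CStarMatrix.ofMatrixₗ (R := ℂ)).toLinearMap ∘ₗ Matrix.singleLinearMap ℂ i j

omit [CompleteSpace H] in
theorem sum_singleₗ {n : ℕ} (M : CStarMatrix (Fin n) (Fin n) (H →L[ℂ] H)) :
    ∑ i, ∑ j, singleₗ i j (M i j) = M :=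
  (Matrix.matrix_eq_sum_single (CStarMatrix.ofMatrix.symm M)).symm

-- The finite-dimensional case of Arveson's theorem. The functional `M ↦ ∑ ⟪e i, θ (M i j) (e j)⟫`
-- extends by Hahn-Banach to a functional `S` on all matrices; `S` attains its bound `n` at `1`,
-- hence is positive. The values of `S` at one-entry matrices are the matrix coefficients of `Φ`.
open InnerProductSpace in
theorem exists_cp_compression {V : Type*} [AddCommGroup V] [Module ℂ V]
    (ι θ : V →ₗ[ℂ] (H →L[ℂ] H)) {u : V} (hι : ι u = 1) (hθ : θ u = 1)
    (h : ∀ (n : ℕ) (M : Matrix (Fin n) (Fin n) V),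
      ‖(CStarMatrix.ofMatrix fun i j => θ (M i j) : CStarMatrix (Fin n) (Fin n) (H →L[ℂ] H))‖ ≤
      ‖(CStarMatrix.ofMatrix fun i j => ι (M i j) : CStarMatrix (Fin n) (Fin n) (H →L[ℂ] H))‖)
    {n : ℕ} {e : Fin n → H} (he : Orthonormal ℂ e) :
    ∃ Φ : (H →L[ℂ] H) →ₗ[ℂ] (H →L[ℂ] H), IsCP Φ ∧
      ∀ v ξ η, ⟪η, Φ (ι v) ξ⟫_ℂ
        = ⟪∑ i, ⟪e i, η⟫_ℂ • e i, θ v (∑ i, ⟪e i, ξ⟫_ℂ • e i)⟫_ℂ := by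
  have hen : tupleNorm e ^ 2 = n := by
    rw [sq_tupleNorm]; simp [he.1]
  let p : Matrix (Fin n) (Fin n) V →ₗ[ℂ] CStarMatrix (Fin n) (Fin n) (H →L[ℂ] H) :=
    { toFun := fun M => CStarMatrix.ofMatrix fun i j => ι (M i j)
      map_add' := fun M N => by ext1 i j; exact map_add ι _ _
      map_smul' := fun c M => by ext1 i j; exact map_smul ι _ _ }
  let s : Matrix (Fin n) (Fin n) V →ₗ[ℂ] ℂ :=
    { toFun := fun M => matForm (fun i j => θ (M i j)) e e
      map_add' := fun M N => by
        simp [matForm, Finset.sum_add_distrib]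
      map_smul' := fun c M => by
        simp [matForm, Finset.mul_sum] }
  obtain ⟨S, hS, hSn⟩ := exists_functional_extension p s (C := n) (by positivity) (fun M => by
    refine (norm_matForm_le (CStarMatrix.ofMatrix fun i j => θ (M i j)) e e).trans ?_
    rw [mul_assoc, ← sq, hen, mul_comm]
    gcongr
    exact h n M)
  have hS1 : S 1 = (n : ℝ) := by
    have h1 : p (Matrix.diagonal fun _ => u) = 1 := by
      ext1 i j
      change ι (Matrix.diagonal (fun _ => u) i j) = _
      rw [CStarMatrix.one_apply, Matrix.diagonal_apply]
      split_ifs <;> simp [hι]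
    rw [← h1, hS]
    change matForm _ e e = _
    rw [matForm]
    have : ∀ i j, ⟪e i, θ (Matrix.diagonal (fun _ => u) i j) (e j)⟫_ℂ
        = if i = j then 1 else 0 := by
      intro i j
      rw [Matrix.diagonal_apply]
      split_ifs with hij
      · subst hij
        rw [hθ, one_apply_eq_self, inner_self_eq_norm_sq_to_K, he.1]; simp
      · simp
    simp [this]
  have hpos : ∀ B : CStarMatrix (Fin n) (Fin n) (H →L[ℂ] H), 0 ≤ S (star B * B) := fun B =>
    functional_nonneg S hSn hS1 (star_mul_self_nonneg B)
  let Φ : (H →L[ℂ] H) →ₗ[ℂ] (H →L[ℂ] H) :=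
    ∑ i, ∑ j, (S ∘ₗ singleₗ i j).smulRight (rankOne ℂ (e i) (e j))
  have hΦ : ∀ a ξ η, ⟪η, Φ a ξ⟫_ℂ = ∑ i, ∑ j, S (singleₗ i j a) * (⟪e j, ξ⟫_ℂ * ⟪η, e i⟫_ℂ) := by
    intro a ξ η
    simp [Φ, sum_apply, LinearMap.sum_apply]
  refine ⟨Φ, fun κ _ a ξ => ?_, fun v ξ η => ?_⟩
  · rcases Nat.eq_zero_or_pos n with rfl | hn
    · simp [matForm, hΦ]
    · set b : Fin n → H →L[ℂ] H := fun j => ∑ l, ⟪e j, ξ l⟫_ℂ • a l with hb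
      -- All `n` rows equal `b`, so `B⋆B` is `n` times the matrix wanted; the factor is divided out,
      -- hence the separate case `n = 0`.
      let B : CStarMatrix (Fin n) (Fin n) (H →L[ℂ] H) := CStarMatrix.ofMatrix fun _ j => b j
      have h0 : ∀ i j, (star B * B) i j
          = (n : ℂ) • ∑ k, ∑ l, (⟪ξ k, e i⟫_ℂ * ⟪e j, ξ l⟫_ℂ) • (star (a k) * a l) := by
        intro i j
        have : (star B * B) i j = ∑ _k : Fin n, star (b i) * b j := by
          rw [CStarMatrix.mul_apply]; rfl
        rw [this, Finset.sum_const, Finset.card_univ, Fintype.card_fin, hb, star_sum,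
          Finset.sum_mul_sum, Nat.cast_smul_eq_nsmul]
        simp only [star_smul, smul_mul_smul_comm, RCLike.star_def, inner_conj_symm]
      have h2 : S (star B * B) = n * matForm (fun i j => Φ (star (a i) * a j)) ξ ξ := by
        rw [← sum_singleₗ (star B * B)]
        simp only [h0, map_sum, map_smul, matForm, hΦ, smul_eq_mul, ← Finset.mul_sum]
        congr 1
        have h3 : ∀ i, ∑ j, ∑ k, ∑ l, ⟪ξ k, e i⟫_ℂ * ⟪e j, ξ l⟫_ℂ * S (singleₗ i j (star (a k) * a l))
            = ∑ k, ∑ l, ∑ j, ⟪ξ k, e i⟫_ℂ * ⟪e j, ξ l⟫_ℂ * S (singleₗ i j (star (a k) * a l)) := by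
          intro i
          rw [Finset.sum_comm]
          exact Finset.sum_congr rfl fun k _ => Finset.sum_comm
        simp only [h3]
        rw [Finset.sum_comm]
        refine Finset.sum_congr rfl fun k _ => ?_
        rw [Finset.sum_comm]
        refine Finset.sum_congr rfl fun l _ => Finset.sum_congr rfl fun i _ =>
          Finset.sum_congr rfl fun j _ => ?_
        ring
      have h1 := hpos B
      rw [h2] at h1
      have hn' : (0 : ℂ) < n := by exact_mod_cast hn
      exact le_of_mul_le_mul_left (by simpa only [mul_zero] using h1) hn'
  · rw [hΦ]
    have h1 : ∀ i j, S (singleₗ i j (ι v)) = ⟪e i, θ v (e j)⟫_ℂ := by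
      intro i j
      have : singleₗ i j (ι v) = p (Matrix.single i j v) := by
        ext1 k l
        change Matrix.single i j (ι v) k l = ι (Matrix.single i j v k l)
        rw [Matrix.single_apply, Matrix.single_apply]
        split_ifs <;> simp
      rw [this, hS]
      change matForm _ e e = _
      rw [matForm]
      rw [Finset.sum_eq_single i, Finset.sum_eq_single j] <;>
        simp +contextual [Matrix.single_apply]
      · intro l hl
        rw [if_neg (fun h => hl h.symm)]; simp
      · intro k hk
        refine Finset.sum_eq_zero fun l _ => ?_
        rw [if_neg (fun h => hk h.1.symm)]; simp
    simp only [h1, sum_inner, map_sum, inner_sum, map_smul, inner_smul_left, inner_smul_right,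
      inner_conj_symm]
    rw [Finset.sum_comm]
    refine Finset.sum_congr rfl fun j _ => ?_
    rw [Finset.mul_sum]
    refine Finset.sum_congr rfl fun i _ => ?_
    ring

/-- **Arveson's extension theorem**: a unital completely contractive map from a space of operators
to `B(H)` extends to `B(H)`. -/
theorem exists_cc_extension {V : Type*} [AddCommGroup V] [Module ℂ V]
    (ι θ : V →ₗ[ℂ] (H →L[ℂ] H)) {u : V} (hι : ι u = 1) (hθ : θ u = 1)
    (h : ∀ (n : ℕ) (M : Matrix (Fin n) (Fin n) V),
      ‖(CStarMatrix.ofMatrix fun i j => θ (M i j) : CStarMatrix (Fin n) (Fin n) (H →L[ℂ] H))‖ ≤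
      ‖(CStarMatrix.ofMatrix fun i j => ι (M i j) : CStarMatrix (Fin n) (Fin n) (H →L[ℂ] H))‖) :
    ∃ Ψ : (H →L[ℂ] H) →ₗ[ℂ] (H →L[ℂ] H), IsCC Ψ ∧ ∀ v, Ψ (ι v) = θ v := by
  obtain ⟨w, b, -⟩ := exists_hilbertBasis ℂ H
  let P : Finset w → H → H := fun F ξ => ∑ i ∈ F, ⟪b i, ξ⟫_ℂ • b i
  have hP : ∀ ξ, Tendsto (fun F => P F ξ) atTop (𝓝 ξ) := by
    intro ξ
    have := b.hasSum_repr ξ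
    rw [HasSum, SummationFilter.unconditional_filter] at this
    simpa only [b.repr_apply_apply] using this
  have hex : ∀ F : Finset w, ∃ Φ : (H →L[ℂ] H) →ₗ[ℂ] (H →L[ℂ] H), IsCC Φ ∧
      ∀ v ξ η, ⟪η, Φ (ι v) ξ⟫_ℂ = ⟪P F η, θ v (P F ξ)⟫_ℂ := by
    intro F
    let e : Fin F.card → H := fun k => b (F.equivFin.symm k)
    have he : Orthonormal ℂ e := b.orthonormal.comp (fun k => (F.equivFin.symm k : w))
      (Subtype.val_injective.comp F.equivFin.symm.injective)
    have hsum : ∀ ξ, ∑ k, ⟪e k, ξ⟫_ℂ • e k = P F ξ := by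
      intro ξ
      rw [F.equivFin.symm.sum_comp (fun i : F => ⟪b i, ξ⟫_ℂ • b i)]
      exact Finset.sum_coe_sort F (fun i => ⟪b i, ξ⟫_ℂ • b i)
    obtain ⟨Φ, hcp, hΦ⟩ := exists_cp_compression ι θ hι hθ h he
    refine ⟨Φ, fun n M => norm_le_of_matForm_le _ (norm_nonneg _)
      (hcp.norm_matForm_le (fun ξ => ?_) M), fun v ξ η => by rw [hΦ, hsum, hsum]⟩
    -- `Φ 1` has the quadratic form of the projection onto the span of `e`, so Bessel's inequality
    -- applies.
    rw [← hι, hΦ, hθ, one_apply_eq_self, sum_inner, Complex.re_sum]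
    refine le_trans (le_of_eq ?_) (he.sum_inner_products_le (s := Finset.univ) ξ)
    refine Finset.sum_congr rfl fun k _ => ?_
    rw [inner_smul_left, he.inner_right_fintype, ← Complex.normSq_eq_conj_mul_self,
      Complex.ofReal_re, Complex.normSq_eq_norm_sq]
  choose Φ hΦcc hΦ using hex
  -- The compressions converge weakly to `θ v` as the finite sets of basis vectors grow.
  obtain ⟨Ψ, hΨ, hlim⟩ := exists_ultralimit (Ultrafilter.of atTop) Φ hΦcc
  refine ⟨Ψ, hΨ, fun v => ?_⟩
  ext ξ
  refine ext_inner_left ℂ fun η => tendsto_nhds_unique (hlim (ι v) ξ η) ?_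
  have h1 : Tendsto (fun F => ⟪P F η, θ v (P F ξ)⟫_ℂ) atTop (𝓝 ⟪η, θ v ξ⟫_ℂ) :=
    (hP η).inner (((θ v).continuous.tendsto ξ).comp (hP ξ))
  simpa only [hΦ] using h1.mono_left (Ultrafilter.of_le _)

/-! ### Unital completely contractive maps: positivity and the Kadison-Schwarz inequality. -/

/-- As a functional of `M`, the form has bound `tupleNorm ξ ^ 2` and attains it at `1`, so
`functional_nonneg` applies. -/
theorem IsCC.matForm_nonneg {Φ : (H →L[ℂ] H) →ₗ[ℂ] (H →L[ℂ] H)} (h : IsCC Φ) (h1 : Φ 1 = 1)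
    {n : ℕ} {M : CStarMatrix (Fin n) (Fin n) (H →L[ℂ] H)} (hM : 0 ≤ M) (ξ : Fin n → H) :
    0 ≤ matForm (M.map Φ) ξ ξ := by
  let f : CStarMatrix (Fin n) (Fin n) (H →L[ℂ] H) →ₗ[ℂ] ℂ :=
    { toFun := fun M => matForm (M.map Φ) ξ ξ
      map_add' := fun M N => by simp [matForm, Finset.sum_add_distrib]
      map_smul' := fun c M => by simp [matForm, Finset.mul_sum] }
  refine functional_nonneg f (r := tupleNorm ξ ^ 2) (fun M => ?_) ?_ hM
  · refine (h.norm_matForm_le M ξ ξ).trans (le_of_eq ?_)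
    ring
  · change ∑ i, ∑ j, ⟪ξ i, Φ ((1 : CStarMatrix (Fin n) (Fin n) (H →L[ℂ] H)) i j) (ξ j)⟫_ℂ = _
    rw [sq_tupleNorm]
    push_cast
    refine Finset.sum_congr rfl fun i _ => ?_
    rw [Finset.sum_eq_single i]
    · rw [CStarMatrix.one_apply_eq, h1, one_apply_eq_self,
        inner_self_eq_norm_sq_to_K]
      rfl
    · intro j _ hj
      rw [CStarMatrix.one_apply_ne hj.symm]
      simp
    · simp

theorem IsCC.apply_nonneg {Φ : (H →L[ℂ] H) →ₗ[ℂ] (H →L[ℂ] H)} (h : IsCC Φ) (h1 : Φ 1 = 1)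
    {a : H →L[ℂ] H} (ha : 0 ≤ a) : 0 ≤ Φ a := by
  refine nonneg_iff_inner_nonneg.mpr fun ξ => ?_
  let f : (H →L[ℂ] H) →ₗ[ℂ] ℂ :=
    { toFun := fun a => ⟪ξ, Φ a ξ⟫_ℂ
      map_add' := fun M N => by simp
      map_smul' := fun c M => by simp }
  refine functional_nonneg f (r := ‖ξ‖ ^ 2) (fun a => ?_) ?_ ha
  · refine (norm_inner_le_norm _ _).trans ?_
    calc ‖ξ‖ * ‖Φ a ξ‖ ≤ ‖ξ‖ * (‖a‖ * ‖ξ‖) := by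
          gcongr; exact (Φ a).le_of_opNorm_le (h.norm_apply_le a) ξ
      _ = _ := by ring
  · change ⟪ξ, Φ 1 ξ⟫_ℂ = _
    rw [h1, one_apply_eq_self, inner_self_eq_norm_sq_to_K]
    norm_cast

theorem IsCC.apply_star {Φ : (H →L[ℂ] H) →ₗ[ℂ] (H →L[ℂ] H)} (h : IsCC Φ) (h1 : Φ 1 = 1)
    (a : H →L[ℂ] H) : Φ (star a) = star (Φ a) :=
  apply_star_of_nonneg (fun _ => h.apply_nonneg h1) a

theorem IsCC.apply_mono {Φ : (H →L[ℂ] H) →ₗ[ℂ] (H →L[ℂ] H)} (h : IsCC Φ) (h1 : Φ 1 = 1)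
    {a b : H →L[ℂ] H} (hab : a ≤ b) : Φ a ≤ Φ b := by
  rw [← sub_nonneg, ← map_sub]
  exact h.apply_nonneg h1 (sub_nonneg.mpr hab)

/-- The Kadison-Schwarz inequality. -/
theorem IsCC.schwarz {Φ : (H →L[ℂ] H) →ₗ[ℂ] (H →L[ℂ] H)} (h : IsCC Φ) (h1 : Φ 1 = 1)
    (b : H →L[ℂ] H) : star (Φ b) * Φ b ≤ Φ (star b * b) := by
  rw [← sub_nonneg]
  refine nonneg_iff_inner_nonneg.mpr fun ξ => ?_
  let B : CStarMatrix (Fin 2) (Fin 2) (H →L[ℂ] H) := CStarMatrix.ofMatrix !![b, 1; 0, 0]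
  have hB : star B * B = CStarMatrix.ofMatrix !![star b * b, star b; b, 1] := by
    ext1 i j
    rw [CStarMatrix.mul_apply, Fin.sum_univ_two, CStarMatrix.star_apply, CStarMatrix.star_apply]
    fin_cases i <;> fin_cases j <;> simp [B]
  -- The second vector `-Φ b ξ` minimizes the form, which leaves the Schur complement `Φ (b⋆b) - (Φ
  -- b)⋆ Φ b`.
  have h2 := h.matForm_nonneg h1 (star_mul_self_nonneg B) ![ξ, -Φ b ξ]
  rw [hB] at h2
  have h3 : ∀ η : H, ⟪ξ, star (Φ b) η⟫_ℂ = ⟪Φ b ξ, η⟫_ℂ := fun η => by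
    rw [ContinuousLinearMap.star_eq_adjoint, ContinuousLinearMap.adjoint_inner_right]
  simp only [matForm, Fin.sum_univ_two, CStarMatrix.map_apply] at h2
  have h4 : ⟪ξ, (Φ (star b * b) - star (Φ b) * Φ b) ξ⟫_ℂ
      = ⟪ξ, Φ (star b * b) ξ⟫_ℂ - ⟪Φ b ξ, Φ b ξ⟫_ℂ := by
    rw [sub_apply, inner_sub_right, mul_apply_eq_comp]
    congr 1
    exact h3 _
  rw [h4]
  convert h2 using 1
  simp [h.apply_star h1, h3, h1]
  ring

/-! ### Maps that fix `X`: minimal seminorms, Cesàro averages and rigidity. -/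

theorem isCC_id : IsCC (LinearMap.id : (H →L[ℂ] H) →ₗ[ℂ] (H →L[ℂ] H)) := fun _ _ => le_rfl

theorem IsCC.comp {Φ Ψ : (H →L[ℂ] H) →ₗ[ℂ] (H →L[ℂ] H)} (hΦ : IsCC Φ) (hΨ : IsCC Ψ) :
    IsCC (Φ ∘ₗ Ψ) := fun n M => (hΦ n (M.map Ψ)).trans (hΨ n M)

theorem IsCC.average {N : ℕ} {Φ : Fin (N + 1) → (H →L[ℂ] H) →ₗ[ℂ] (H →L[ℂ] H)}
    (h : ∀ k, IsCC (Φ k)) : IsCC (((N : ℂ) + 1)⁻¹ • ∑ k, Φ k) := by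
  intro n M
  have h0 : ∀ s : Finset (Fin (N + 1)), 
      M.map ⇑(∑ k ∈ s, Φ k : (H →L[ℂ] H) →ₗ[ℂ] (H →L[ℂ] H)) = ∑ k ∈ s, M.map (Φ k) := by
    intro s
    induction s using Finset.induction_on with
    | empty => rfl
    | insert k s hk ih => rw [Finset.sum_insert hk, Finset.sum_insert hk, ← ih]; rfl
  have h1 : M.map (((N : ℂ) + 1)⁻¹ • ∑ k, Φ k) = ((N : ℂ) + 1)⁻¹ • ∑ k, M.map (Φ k) := by
    rw [← h0]; rfl
  rw [h1, norm_smul]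
  have h2 : ‖∑ k, M.map (Φ k)‖ ≤ (N + 1) * ‖M‖ := by
    refine (norm_sum_le_of_le _ fun k _ => h k n M).trans (le_of_eq ?_)
    simp
  have h3 : ‖((N : ℂ) + 1)⁻¹‖ = ((N : ℝ) + 1)⁻¹ := by
    rw [norm_inv]
    congr 1
    exact_mod_cast Complex.norm_natCast (N + 1)
  rw [h3, inv_mul_le_iff₀ (by positivity)]
  exact h2

omit [CompleteSpace H] in
theorem norm_le_of_tendsto_inner {ι : Type*} {l : Filter ι} [l.NeBot] {T : ι → H →L[ℂ] H}
    {S : H →L[ℂ] H} (h : ∀ ξ η, Tendsto (fun i => ⟪η, T i ξ⟫_ℂ) l (𝓝 ⟪η, S ξ⟫_ℂ)) {C : ℝ}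
    (hC : 0 ≤ C) (hT : ∀ᶠ i in l, ‖T i‖ ≤ C) : ‖S‖ ≤ C := by
  refine opNorm_le_of_inner_le _ hC fun ξ η => le_of_tendsto (h ξ η).norm ?_
  filter_upwards [hT] with i hi
  refine (norm_inner_le_norm _ _).trans ?_
  rw [mul_comm]
  gcongr
  exact (T i).le_of_opNorm_le hi ξ

/-- The completely contractive maps on `B(H)` that fix the elements of `X`. -/
def fixing (X : Submodule ℂ (H →L[ℂ] H)) : Set ((H →L[ℂ] H) →ₗ[ℂ] (H →L[ℂ] H)) :=
  {Φ | IsCC Φ ∧ ∀ x ∈ X, Φ x = x}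

variable {X : Submodule ℂ (H →L[ℂ] H)}

theorem comp_mem_fixing {Φ Ψ : (H →L[ℂ] H) →ₗ[ℂ] (H →L[ℂ] H)} (hΦ : Φ ∈ fixing X)
    (hΨ : Ψ ∈ fixing X) : Φ ∘ₗ Ψ ∈ fixing X :=
  ⟨hΦ.1.comp hΨ.1, fun x hx => by rw [LinearMap.comp_apply, hΨ.2 x hx, hΦ.2 x hx]⟩

theorem exists_ultralimit_mem_fixing {ι : Type*} (𝒰 : Ultrafilter ι)
    (Φ : ι → (H →L[ℂ] H) →ₗ[ℂ] (H →L[ℂ] H)) (hΦ : ∀ i, Φ i ∈ fixing X) :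
    ∃ Ψ ∈ fixing X, ∀ a ξ η, Tendsto (fun i => ⟪η, Φ i a ξ⟫_ℂ) 𝒰 (𝓝 ⟪η, Ψ a ξ⟫_ℂ) := by
  obtain ⟨Ψ, hΨ, hlim⟩ := exists_ultralimit 𝒰 Φ fun i => (hΦ i).1
  refine ⟨Ψ, ⟨hΨ, fun x hx => ?_⟩, hlim⟩
  ext ξ
  refine ext_inner_left ℂ fun η => tendsto_nhds_unique (hlim x ξ η) ?_
  simp only [(hΦ _).2 x hx]
  exact tendsto_const_nhds

/-- A map that fixes `X` and whose seminorm `a ↦ ‖Φ a‖` is minimal exists. -/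
theorem exists_minimal_seminorm (X : Submodule ℂ (H →L[ℂ] H)) :
    ∃ Φ ∈ fixing X, ∀ Ψ ∈ fixing X, (∀ a, ‖Ψ a‖ ≤ ‖Φ a‖) → ∀ a, ‖Φ a‖ ≤ ‖Ψ a‖ := by
  let r : fixing X → fixing X → Prop := fun Φ Ψ => ∀ a, ‖Ψ.1 a‖ ≤ ‖Φ.1 a‖
  obtain ⟨Φ, hΦ⟩ := exists_maximal_of_chains_bounded (r := r) (fun c hc => by
    rcases c.eq_empty_or_nonempty with rfl | hne
    · exact ⟨⟨LinearMap.id, isCC_id, fun _ _ => rfl⟩, by simp⟩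
    · let _ : Preorder c :=
        { le := fun a b => r a b
          le_refl := fun a _ => le_rfl
          le_trans := fun a b d hab hbd x => (hbd x).trans (hab x) }
      have : Nonempty c := hne.to_subtype
      have : IsDirectedOrder c := ⟨fun a b => by
        rcases eq_or_ne a b with rfl | hab
        · exact ⟨a, le_rfl, le_rfl⟩
        · rcases hc a.2 b.2 (fun h => hab (Subtype.ext h)) with h | h
          · exact ⟨b, h, le_rfl⟩
          · exact ⟨a, le_rfl, h⟩⟩
      obtain ⟨Ψ, hΨ, hlim⟩ := exists_ultralimit_mem_fixing (Ultrafilter.of (atTop : Filter c))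
        (fun i => i.1.1) (fun i => i.1.2)
      refine ⟨⟨Ψ, hΨ⟩, fun Φ hΦ a => ?_⟩
      refine norm_le_of_tendsto_inner (hlim a) (norm_nonneg _) ?_
      refine Ultrafilter.of_le _ ?_
      filter_upwards [eventually_ge_atTop (⟨Φ, hΦ⟩ : c)] with i hi
      exact hi a) (fun hab hbd x => (hbd x).trans (hab x))
  exact ⟨Φ.1, Φ.2, fun Ψ hΨ h => hΦ ⟨Ψ, hΨ⟩ h⟩

theorem pow_mem_fixing {Φ : (H →L[ℂ] H) →ₗ[ℂ] (H →L[ℂ] H)} (hΦ : Φ ∈ fixing X) (k : ℕ) :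
    Φ ^ k ∈ fixing X := by
  induction k with
  | zero => exact ⟨isCC_id, fun _ _ => rfl⟩
  | succ k ih =>
    rw [pow_succ]
    exact comp_mem_fixing ih hΦ

/-- The Cesàro averages of the powers of `χ` have a cluster point. -/
theorem exists_cesaro_limit {χ : Module.End ℂ (H →L[ℂ] H)} (hχ : χ ∈ fixing X) :
    ∃ Θ ∈ fixing X, (∀ a, Θ (a - χ a) = 0) ∧
      ∀ a C, (∀ k : ℕ, ‖(χ ^ (k + 1)) a‖ ≤ C) → ‖Θ a‖ ≤ C := by
  let A : ℕ → Module.End ℂ (H →L[ℂ] H) := fun N =>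
    -- The powers start at `1`, so that for `χ = Ψ ∘ E` every term is dominated by `‖E a‖`.
    ((N : ℂ) + 1)⁻¹ • ∑ k : Fin (N + 1), χ ^ ((k : ℕ) + 1)
  have hAa : ∀ N a, A N a = ((N : ℂ) + 1)⁻¹ • ∑ k : Fin (N + 1), (χ ^ ((k : ℕ) + 1)) a := by
    intro N a
    simp only [A, LinearMap.smul_apply, LinearMap.sum_apply]
  have hA : ∀ N, A N ∈ fixing X := by
    refine fun N => ⟨IsCC.average fun k => (pow_mem_fixing hχ _).1, fun x hx => ?_⟩
    rw [hAa, Finset.sum_congr rfl fun k _ => (pow_mem_fixing hχ _).2 x hx, Finset.sum_const,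
      Finset.card_univ, Fintype.card_fin, ← Nat.cast_smul_eq_nsmul ℂ, smul_smul]
    push_cast
    rw [inv_mul_cancel₀ (Nat.cast_add_one_ne_zero N), one_smul]
  have hnorm : ∀ N : ℕ, ‖((N : ℂ) + 1)⁻¹‖ = ((N : ℝ) + 1)⁻¹ := by
    intro N
    rw [norm_inv]
    congr 1
    exact_mod_cast Complex.norm_natCast (N + 1)
  obtain ⟨Θ, hΘ, hlim⟩ := exists_ultralimit_mem_fixing (hyperfilter ℕ) A hA
  refine ⟨Θ, hΘ, fun a => ?_, fun a C hC => ?_⟩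
  · ext ξ
    refine ext_inner_left ℂ fun η => ?_
    rw [zero_apply, inner_zero_right]
    refine tendsto_nhds_unique (hlim _ ξ η) ?_
    have htel : ∀ N, A N (a - χ a) = ((N : ℂ) + 1)⁻¹ • (χ a - (χ ^ (N + 2)) a) := by
      intro N
      rw [hAa]
      congr 1
      have : ∀ k : ℕ, (χ ^ (k + 1)) (a - χ a) = (χ ^ (k + 1)) a - (χ ^ (k + 1 + 1)) a := fun k => by
        rw [map_sub, pow_succ χ (k + 1), Module.End.mul_apply]
      rw [Finset.sum_congr rfl fun (k : Fin (N + 1)) _ => this k,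
        Fin.sum_univ_eq_sum_range (fun k => (χ ^ (k + 1)) a - (χ ^ (k + 1 + 1)) a) (N + 1),
        Finset.sum_range_sub' (fun k => (χ ^ (k + 1)) a), zero_add, pow_one]
    have hbound : ∀ N : ℕ, ‖⟪η, A N (a - χ a) ξ⟫_ℂ‖
        ≤ (‖η‖ * ((‖a‖ + ‖a‖) * ‖ξ‖)) * (1 / ((N : ℝ) + 1)) := by
      intro N
      refine (norm_inner_le_norm _ _).trans ?_
      have h1 : ‖A N (a - χ a)‖ ≤ (1 / ((N : ℝ) + 1)) * (‖a‖ + ‖a‖) := by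
        rw [htel, norm_smul, hnorm, one_div]
        gcongr
        exact (norm_sub_le _ _).trans (add_le_add (hχ.1.norm_apply_le a)
          ((pow_mem_fixing hχ _).1.norm_apply_le a))
      calc ‖η‖ * ‖A N (a - χ a) ξ‖ ≤ ‖η‖ * ((1 / ((N : ℝ) + 1)) * (‖a‖ + ‖a‖) * ‖ξ‖) := by
            gcongr
            exact (A N _).le_of_opNorm_le h1 ξ
        _ = _ := by ring
    have h0 : Tendsto (fun N => ⟪η, A N (a - χ a) ξ⟫_ℂ) atTop (𝓝 0) := by
      refine squeeze_zero_norm hbound ?_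
      simpa only [mul_zero] using
        tendsto_one_div_add_atTop_nhds_zero_nat.const_mul (‖η‖ * ((‖a‖ + ‖a‖) * ‖ξ‖))
    exact h0.mono_left Nat.hyperfilter_le_atTop
  · refine norm_le_of_tendsto_inner (hlim a) ((norm_nonneg _).trans (hC 0))
      (Eventually.of_forall fun N => ?_)
    rw [hAa, norm_smul, hnorm, inv_mul_le_iff₀ (by positivity)]
    have hsum := norm_sum_le_of_le Finset.univ fun (k : Fin (N + 1)) _ => hC k
    rw [Finset.sum_const, Finset.card_univ, Fintype.card_fin, nsmul_eq_mul] at hsum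
    push_cast at hsum
    exact hsum

/-- Minimality of the seminorm implies rigidity. -/
theorem exists_minimal (X : Submodule ℂ (H →L[ℂ] H)) :
    ∃ E ∈ fixing X, ∀ Ψ ∈ fixing X, ∀ a, E (Ψ (E a)) = E a := by
  obtain ⟨E, hE, hmin⟩ := exists_minimal_seminorm X
  refine ⟨E, hE, fun Ψ hΨ a => ?_⟩
  obtain ⟨Θ, hΘ, hzero, hle⟩ := exists_cesaro_limit (χ := Ψ ∘ₗ E) (comp_mem_fixing hΨ hE)
  have h1 := hmin Θ hΘ (fun b => hle b _ fun k => by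
    rw [pow_succ, Module.End.mul_apply]
    exact ((pow_mem_fixing (comp_mem_fixing hΨ hE) k).1.norm_apply_le _).trans
      (hΨ.1.norm_apply_le _)) (a - Ψ (E a))
  have h2 : Θ (a - Ψ (E a)) = 0 := hzero a
  rw [h2, norm_zero, norm_le_zero_iff, map_sub, sub_eq_zero] at h1
  exact h1.symm

/-! ### The Choi-Effros product and uniqueness on `C*(X)`. -/

/-- The Choi-Effros identity at elements that are fixed by an idempotent map. -/
theorem choiEffros {E : (H →L[ℂ] H) →ₗ[ℂ] (H →L[ℂ] H)} (hE : IsCC E) (h1 : E 1 = 1)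
    (hEE : ∀ a, E (E a) = E a) {x : H →L[ℂ] H} (hx : E x = x) (b : H →L[ℂ] H) :
    E (x * b) = E (x * E b) := by
  set d := b - E b with hd
  have hEd : E d = 0 := by rw [hd, map_sub, hEE, sub_self]
  suffices h : E (x * d) = 0 by
    rwa [hd, mul_sub, map_sub, sub_eq_zero] at h
  have hsx : E (star x) = star x := by rw [hE.apply_star h1, hx]
  -- Kadison-Schwarz at `star x + c • d`, then `E` once more. The terms linear in `c` must vanish,
  -- since the remaining one is quadratic.
  have key : ∀ c : ℂ, 0 ≤ c • E (x * d) + (star c • star (E (x * d))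
      + (star c * c) • E (star d * d)) := by
    intro c
    have hs := hE.schwarz h1 (star x + c • d)
    have hEc : E (star x + c • d) = star x := by rw [map_add, map_smul, hEd, hsx]; simp
    rw [hEc, star_star] at hs
    have hs2 := hE.apply_mono h1 hs
    rw [hEE, ← sub_nonneg, ← map_sub] at hs2
    have h2 : star (star x + c • d) * (star x + c • d) - x * star x
        = c • (x * d) + (star c • star (x * d) + (star c * c) • (star d * d)) := by
      simp only [star_add, star_star, star_smul, star_mul, add_mul, mul_add, smul_mul_assoc,
        mul_smul_comm]
      module
    rw [h2] at hs2
    simpa only [map_add, map_smul, hE.apply_star h1] using hs2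
  set T := E (x * d) with hT
  have hinner : ∀ ξ, ⟪T ξ, ξ⟫_ℂ = 0 := by
    intro ξ
    set z := ⟪ξ, T ξ⟫_ℂ with hz
    suffices hz0 : z = 0 by
      rw [← inner_conj_symm, ← hz, hz0, map_zero]
    by_contra hne
    set q := (⟪ξ, E (star d * d) ξ⟫_ℂ).re with hq
    have h3 : ∀ t : ℝ, 0 < t → 2 ≤ t * q := by
      intro t ht
      have h4 := (Complex.nonneg_iff.mp
        (nonneg_iff_inner_nonneg.mp (key (-(t : ℂ) * (starRingEnd ℂ) z)) ξ)).1
      have h5 : ⟪ξ, star T ξ⟫_ℂ = (starRingEnd ℂ) z := by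
        rw [ContinuousLinearMap.star_eq_adjoint, ContinuousLinearMap.adjoint_inner_right, hz,
          inner_conj_symm]
      simp only [add_apply, smul_apply, inner_add_right, inner_smul_right, h5, ← hz] at h4
      have h6 : -(t : ℂ) * (starRingEnd ℂ) z * z = ((-(t * Complex.normSq z) : ℝ) : ℂ) := by
        push_cast [Complex.normSq_eq_conj_mul_self]; ring
      have h7 : star (-(t : ℂ) * (starRingEnd ℂ) z) * (starRingEnd ℂ) z
          = ((-(t * Complex.normSq z) : ℝ) : ℂ) := by
        push_cast [Complex.normSq_eq_conj_mul_self]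
        simp only [RCLike.star_def, map_mul, map_neg, Complex.conj_ofReal, Complex.conj_conj]
        ring
      have h8 : star (-(t : ℂ) * (starRingEnd ℂ) z) * (-(t : ℂ) * (starRingEnd ℂ) z)
          = ((t * (t * Complex.normSq z) : ℝ) : ℂ) := by
        push_cast [Complex.normSq_eq_conj_mul_self]
        simp only [RCLike.star_def, map_mul, map_neg, Complex.conj_ofReal, Complex.conj_conj]
        ring
      rw [h6, h7, h8, Complex.add_re, Complex.add_re, Complex.re_ofReal_mul, Complex.ofReal_re,
        ← hq] at h4
      have h9 : 0 < t * Complex.normSq z := mul_pos ht (Complex.normSq_pos.mpr hne)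
      have h10 : 0 ≤ (t * Complex.normSq z) * (t * q - 2) := by linarith
      have h11 := nonneg_of_mul_nonneg_right h10 h9
      linarith
    have h4 := h3 (1 / (|q| + 1)) (by positivity)
    have h5 : 1 / (|q| + 1) * q ≤ 1 := by
      rw [one_div, inv_mul_le_iff₀ (by positivity)]
      linarith [le_abs_self q]
    linarith
  have h0 := (inner_map_self_eq_zero (T : H →ₗ[ℂ] H)).mp hinner
  ext ξ
  exact LinearMap.congr_fun h0 ξ

/-- Two idempotent maps with the same range induce the same product on it. -/
theorem apply_mul_eq_of_same_range {E F : (H →L[ℂ] H) →ₗ[ℂ] (H →L[ℂ] H)} (hE : IsCC E)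
    (hE1 : E 1 = 1) (hF : IsCC F) (hF1 : F 1 = 1) (hFE : ∀ a, F (E a) = E a)
    (hEF : ∀ a, E (F a) = F a) {y z : H →L[ℂ] H} (hy : E y = y) (hz : E z = z) :
    E (y * z) = F (y * z) := by
  have hsq : ∀ {y}, E y = y → E (star y * y) = F (star y * y) := by
    intro y hy
    have hy' : F y = y := by rw [← hy, hFE]
    refine le_antisymm ?_ ?_
    -- Schwarz for `F` reads `y⋆y ≤ F (y⋆y)`; applying `E` and using `E ∘ F = F` gives one
    -- inequality, and the other is symmetric.
    · have := hE.apply_mono hE1 (hF.schwarz hF1 y)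
      rwa [hy', hEF] at this
    · have := hF.apply_mono hF1 (hE.schwarz hE1 y)
      rwa [hy, hFE] at this
  have hpol : ∀ {y z}, E y = y → E z = z → E (star y * z) = F (star y * z) := by
    intro y z hy hz
    have h1 := hsq (y := y + z) (by rw [map_add, hy, hz])
    have h2 := hsq (y := y + Complex.I • z) (by rw [map_add, map_smul, hy, hz])
    have h3 := hsq hy
    have h4 := hsq hz
    have hI : star Complex.I = -Complex.I := Complex.conj_I
    simp only [star_add, star_smul, add_mul, mul_add, smul_mul_assoc, mul_smul_comm, map_add,
      map_smul, h3, h4, hI] at h1 h2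
    have h5 : E (star y * z) - F (star y * z) = -(E (star z * y) - F (star z * y)) := by
      linear_combination (norm := module) h1
    have h6 : Complex.I • (E (star y * z) - F (star y * z))
        = Complex.I • (E (star z * y) - F (star z * y)) := by
      rw [smul_sub, smul_sub]
      linear_combination (norm := module) h2
    have h7 := smul_right_injective _ Complex.I_ne_zero h6
    rw [← sub_eq_zero]
    have h8 : (2 : ℂ) • (E (star y * z) - F (star y * z)) = 0 := by
      rw [two_smul]
      nth_rewrite 1 [h5]
      rw [h7]
      abel
    exact (smul_eq_zero.mp h8).resolve_left two_ne_zero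
  have := hpol (y := star y) (z := z) (by rw [hE.apply_star hE1, hy]) hz
  rwa [star_star] at this

/-- Reduces stability under `C*(X)` to the generators, where the Choi-Effros identity is available
because `E` fixes `X` and its adjoints. -/
theorem mul_mem_of_mem_cstar {T : Submodule ℂ (H →L[ℂ] H)} (hT : IsClosed (T : Set (H →L[ℂ] H)))
    (h : ∀ x ∈ X, ∀ d ∈ T, x * d ∈ T) (h' : ∀ x ∈ X, ∀ d ∈ T, star x * d ∈ T)
    {c : H →L[ℂ] H} (hc : c ∈ cstar X) {d : H →L[ℂ] H} (hd : d ∈ T) : c * d ∈ T := by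
  have hadj : ∀ c ∈ StarAlgebra.adjoin ℂ (X : Set (H →L[ℂ] H)), ∀ d ∈ T, c * d ∈ T := by
    intro c hc
    rw [← StarSubalgebra.mem_toSubalgebra, StarAlgebra.adjoin_toSubalgebra] at hc
    induction hc using Algebra.adjoin_induction with
    | mem x hx =>
      rcases hx with hx | hx
      · exact h x hx
      · intro d hd
        simpa using h' (star x) hx d hd
    | algebraMap r =>
      intro d hd
      rw [Algebra.algebraMap_eq_smul_one, smul_mul_assoc, one_mul]
      exact T.smul_mem r hd
    | add x y _ _ hx hy =>
      intro d hd
      rw [add_mul]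
      exact T.add_mem (hx d hd) (hy d hd)
    | mul x y _ _ hx hy =>
      intro d hd
      rw [mul_assoc]
      exact hx _ (hy d hd)
  have hcl : IsClosed {c : H →L[ℂ] H | c * d ∈ T} := hT.preimage (continuous_mul_const d)
  exact closure_minimal (fun c hc => hadj c hc d hd) hcl hc

theorem le_cstar {x : H →L[ℂ] H} (hx : x ∈ X) : x ∈ cstar X :=
  StarSubalgebra.le_topologicalClosure _ (StarAlgebra.subset_adjoin ℂ _ hx)

theorem IsCC.continuous {Φ : (H →L[ℂ] H) →ₗ[ℂ] (H →L[ℂ] H)} (h : IsCC Φ) : Continuous Φ :=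
  AddMonoidHomClass.continuous_of_bound Φ 1 fun a => by rw [one_mul]; exact h.norm_apply_le a

/-- The maps that fix `X` and are rigid in the sense of Hamana. -/
structure IsRigid (X : Submodule ℂ (H →L[ℂ] H)) (E : (H →L[ℂ] H) →ₗ[ℂ] (H →L[ℂ] H)) : Prop where
  mem : E ∈ fixing X
  rigid : ∀ Ψ ∈ fixing X, ∀ a, E (Ψ (E a)) = E a

theorem IsRigid.idem {E : (H →L[ℂ] H) →ₗ[ℂ] (H →L[ℂ] H)} (h : IsRigid X E) (a : H →L[ℂ] H) :
    E (E a) = E a := h.rigid LinearMap.id ⟨isCC_id, fun _ _ => rfl⟩ a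

theorem IsRigid.apply_mul_eq_zero {E : (H →L[ℂ] H) →ₗ[ℂ] (H →L[ℂ] H)} (h : IsRigid X E)
    (hX : 1 ∈ X) {c d : H →L[ℂ] H} (hc : c ∈ cstar X) (hd : E d = 0) : E (c * d) = 0 := by
  have h1 := h.mem.2 1 hX
  have hker : ∀ x, E x = x → ∀ d ∈ LinearMap.ker E, x * d ∈ LinearMap.ker E := by
    intro x hx d hd
    rw [LinearMap.mem_ker] at hd ⊢
    rw [choiEffros h.mem.1 h1 h.idem hx, hd, mul_zero, map_zero]
  have hcl : IsClosed (LinearMap.ker E : Set (H →L[ℂ] H)) :=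
    isClosed_singleton.preimage h.mem.1.continuous
  exact mul_mem_of_mem_cstar (X := X) hcl (fun x hx => hker x (h.mem.2 x hx))
    (fun x hx => hker (star x) (by rw [h.mem.1.apply_star h1, h.mem.2 x hx])) hc hd

/-- Uniqueness of the map that a rigid map induces on `C*(X)`. -/
theorem IsRigid.apply_apply {E Ψ : (H →L[ℂ] H) →ₗ[ℂ] (H →L[ℂ] H)} (h : IsRigid X E)
    (hX : 1 ∈ X) (hΨ : Ψ ∈ fixing X) {c : H →L[ℂ] H} (hc : c ∈ cstar X) : E (Ψ c) = E c := by
  have h1 := h.mem.2 1 hX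
  set F := E ∘ₗ Ψ with hF
  have hFm : F ∈ fixing X := comp_mem_fixing h.mem hΨ
  have hF1 := hFm.2 1 hX
  have hFE : ∀ a, F (E a) = E a := h.rigid Ψ hΨ
  have hEF : ∀ a, E (F a) = F a := fun a => h.idem _
  have hFF : ∀ a, F (F a) = F a := fun a => by rw [← hEF a, hFE]
  have hker : ∀ x, E x = x → F x = x → ∀ d ∈ LinearMap.ker (E - F),
      x * d ∈ LinearMap.ker (E - F) := by
    intro x hx hx' d hd
    rw [LinearMap.mem_ker, LinearMap.sub_apply, sub_eq_zero] at hd ⊢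
    rw [choiEffros h.mem.1 h1 h.idem hx, choiEffros hFm.1 hF1 hFF hx', ← hd]
    exact apply_mul_eq_of_same_range h.mem.1 h1 hFm.1 hF1 hFE hEF hx (h.idem d)
  have hcl : IsClosed (LinearMap.ker (E - F) : Set (H →L[ℂ] H)) :=
    isClosed_singleton.preimage (h.mem.1.continuous.sub hFm.1.continuous)
  have h2 := mul_mem_of_mem_cstar (X := X) hcl
    (fun x hx => hker x (h.mem.2 x hx) (hFm.2 x hx))
    (fun x hx => hker (star x) (by rw [h.mem.1.apply_star h1, h.mem.2 x hx])
      (by rw [hFm.1.apply_star hF1, hFm.2 x hx])) hc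
    -- `E` and `F` agree at `1`, hence on `C*(X) * 1`.
    (d := 1) (by rw [LinearMap.mem_ker, LinearMap.sub_apply, h1, hF1, sub_self])
  rw [mul_one, LinearMap.mem_ker, LinearMap.sub_apply, sub_eq_zero] at h2
  exact h2.symm

theorem exists_isRigid (X : Submodule ℂ (H →L[ℂ] H)) : ∃ E, IsRigid X E := by
  obtain ⟨E, hE, h⟩ := exists_minimal X
  exact ⟨E, hE, h⟩

/-! ### The kernel of a rigid map is the Šilov ideal and the union of abnormalities. -/

/-- The kernel in `C*(X)` of a rigid map. -/
noncomputable def IsRigid.ideal {E : (H →L[ℂ] H) →ₗ[ℂ] (H →L[ℂ] H)} (h : IsRigid X E)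
    (hX : 1 ∈ X) : TwoSidedIdeal (cstar X) :=
  .mk' {c | E c = 0} (map_zero E)
    (fun {x y} hx hy => by
      change E ((x : H →L[ℂ] H) + y) = 0
      rw [map_add, hx, hy, add_zero])
    (fun {x} hx => by
      change E (-(x : H →L[ℂ] H)) = 0
      rw [map_neg, hx, neg_zero])
    (fun {x y} hy => h.apply_mul_eq_zero hX x.2 hy)
    (fun {x y} hx => by
      have h1 := h.mem.2 1 hX
      change E ((x : H →L[ℂ] H) * y) = 0
      rw [← star_star ((x : H →L[ℂ] H) * y), star_mul, h.mem.1.apply_star h1,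
        h.apply_mul_eq_zero hX (star_mem y.2), star_zero]
      rw [h.mem.1.apply_star h1, hx, star_zero])

theorem IsRigid.mem_ideal {E : (H →L[ℂ] H) →ₗ[ℂ] (H →L[ℂ] H)} (h : IsRigid X E) (hX : 1 ∈ X)
    {c : cstar X} : c ∈ h.ideal hX ↔ E c = 0 :=
  TwoSidedIdeal.mem_mk' ..

theorem quotientMatNorm_le {C : StarSubalgebra ℂ (H →L[ℂ] H)} {I : TwoSidedIdeal C} {n : ℕ}
    (M Y : CStarMatrix (Fin n) (Fin n) C) (hY : ∀ i j, Y i j ∈ I) :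
    quotientMatNorm I M ≤ matNorm (M + Y) :=
  ciInf_le ⟨0, by rintro _ ⟨Z, rfl⟩; exact norm_nonneg _⟩
    (⟨Y, hY⟩ : {Y : CStarMatrix (Fin n) (Fin n) C // ∀ i j, Y i j ∈ I})

/-- For `M` over `X` and `Y` over the kernel, `M = E (M + Y)` entrywise, so complete contractivity
of `E` bounds the norm of `M` by that of `M + Y`. -/
theorem IsRigid.isBoundaryIdeal {E : (H →L[ℂ] H) →ₗ[ℂ] (H →L[ℂ] H)} (h : IsRigid X E)
    (hX : 1 ∈ X) : IsBoundaryIdeal X (h.ideal hX) where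
  isClosed := by
    have : (h.ideal hX : Set (cstar X)) = (fun c : cstar X => E c) ⁻¹' {0} := by
      ext c
      exact h.mem_ideal hX
    rw [this]
    exact isClosed_singleton.preimage (h.mem.1.continuous.comp continuous_subtype_val)
  completelyIsometric n M hM := by
    refine le_antisymm ?_ ?_
    · simpa using quotientMatNorm_le (I := h.ideal hX) M 0 fun _ _ => TwoSidedIdeal.zero_mem _
    · have : Nonempty {Y : CStarMatrix (Fin n) (Fin n) (cstar X) // ∀ i j, Y i j ∈ h.ideal hX} :=
        ⟨⟨0, fun _ _ => TwoSidedIdeal.zero_mem _⟩⟩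
      refine le_ciInf fun Y => ?_
      have h1 : (M.map (fun c => (c : H →L[ℂ] H)) : CStarMatrix (Fin n) (Fin n) (H →L[ℂ] H))
          = ((M + Y.1).map (fun c => (c : H →L[ℂ] H))).map E := by
        ext1 i j
        change (M i j : H →L[ℂ] H) = E ((M i j : H →L[ℂ] H) + (Y.1 i j : H →L[ℂ] H))
        rw [map_add, h.mem.2 _ (hM i j), (h.mem_ideal hX).mp (Y.2 i j), add_zero]
      rw [matNorm, h1]
      exact h.mem.1 n _

/-- The elements of a two-sided ideal as a linear subspace. -/
def idealSubmodule {C : StarSubalgebra ℂ (H →L[ℂ] H)} (I : TwoSidedIdeal C) : Submodule ℂ C where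
  carrier := I
  add_mem' := I.add_mem
  zero_mem' := I.zero_mem
  smul_mem' c x hx := by
    rw [← one_mul x, ← smul_mul_assoc]
    exact I.mul_mem_left _ _ hx

/-- A boundary ideal is annihilated by some completely contractive map that fixes `X`. -/
theorem IsBoundaryIdeal.exists_mem_fixing {J : TwoSidedIdeal (cstar X)} (hJ : IsBoundaryIdeal X J)
    (hX : 1 ∈ X) : ∃ Ψ ∈ fixing X, ∀ y ∈ J, Ψ (y : H →L[ℂ] H) = 0 := by
  -- The extension theorem does not ask `ι` to be injective, so `X` and `J` need not be shown
  -- independent. Its norm hypothesis is exactly the boundary property.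
  let ι : X × idealSubmodule J →ₗ[ℂ] (H →L[ℂ] H) :=
    X.subtype.coprod ((cstar X).toSubalgebra.toSubmodule.subtype ∘ₗ (idealSubmodule J).subtype)
  let θ : X × idealSubmodule J →ₗ[ℂ] (H →L[ℂ] H) := X.subtype ∘ₗ LinearMap.fst ℂ _ _
  obtain ⟨Ψ, hΨ, hext⟩ := exists_cc_extension ι θ (u := (⟨1, hX⟩, 0)) (by simp [ι]) (by simp [θ])
    (fun n M => by
      let P : CStarMatrix (Fin n) (Fin n) (cstar X) :=
        CStarMatrix.ofMatrix fun i j => ⟨(M i j).1, le_cstar (M i j).1.2⟩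
      let Y : CStarMatrix (Fin n) (Fin n) (cstar X) :=
        CStarMatrix.ofMatrix fun i j => ((M i j).2 : cstar X)
      have h1 := quotientMatNorm_le (I := J) P Y fun i j => (M i j).2.2
      rwa [hJ.completelyIsometric n P fun i j => (M i j).1.2] at h1)
  refine ⟨Ψ, ⟨hΨ, fun x hx => ?_⟩, fun y hy => ?_⟩
  · simpa [ι, θ] using hext (⟨x, hx⟩, 0)
  · have := hext (0, ⟨y, hy⟩)
    have h2 : ι (0, ⟨y, hy⟩) = (y : H →L[ℂ] H) := by
      simp only [ι, LinearMap.coprod_apply, map_zero, zero_add]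
      rfl
    rw [h2] at this
    rw [this]
    simp [θ]

theorem IsRigid.isSilovIdeal {E : (H →L[ℂ] H) →ₗ[ℂ] (H →L[ℂ] H)} (h : IsRigid X E)
    (hX : 1 ∈ X) : IsSilovIdeal X (h.ideal hX) := by
  refine ⟨h.isBoundaryIdeal hX, fun J hJ y hy => ?_⟩
  obtain ⟨Ψ, hΨ, hzero⟩ := IsBoundaryIdeal.exists_mem_fixing hJ hX
  refine (h.mem_ideal hX).mpr ?_
  rw [← h.apply_apply hX hΨ y.2, hzero y hy, map_zero]

theorem exists_mem_fixing_of_mem_extId {φ : cstar X →ₗ[ℂ] (H →L[ℂ] H)} (hφ : φ ∈ extId X) :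
    ∃ Ψ ∈ fixing X, ∀ c : cstar X, Ψ c = φ c := by
  obtain ⟨Ψ, hΨ, hext⟩ := exists_cc_extension (cstar X).toSubalgebra.toSubmodule.subtype φ
    (u := (1 : cstar X)) rfl hφ.1.map_one (fun n M => hφ.1.norm_map_le n (CStarMatrix.ofMatrix M))
  refine ⟨Ψ, ⟨hΨ, fun x hx => ?_⟩, hext⟩
  exact (hext ⟨x, le_cstar hx⟩).trans (hφ.2 ⟨x, le_cstar hx⟩ hx)

theorem IsRigid.restrict_mem_extId {E : (H →L[ℂ] H) →ₗ[ℂ] (H →L[ℂ] H)} (h : IsRigid X E)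
    (hX : 1 ∈ X) : E ∘ₗ (cstar X).toSubalgebra.toSubmodule.subtype ∈ extId X :=
  ⟨⟨h.mem.2 1 hX, fun n M => h.mem.1 n (M.map fun c => (c : H →L[ℂ] H))⟩,
    fun c hc => h.mem.2 c hc⟩

theorem IsRigid.iUnion_abnormalities {E : (H →L[ℂ] H) →ₗ[ℂ] (H →L[ℂ] H)} (h : IsRigid X E)
    (hX : 1 ∈ X) : (⋃ φ ∈ extId X, abnormalities φ) = (h.ideal hX : Set (cstar X)) := by
  ext a
  rw [SetLike.mem_coe, h.mem_ideal hX]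
  simp only [Set.mem_iUnion, exists_prop]
  constructor
  · rintro ⟨φ, hφ, c, hc⟩
    obtain ⟨Ψ, hΨ, hext⟩ := exists_mem_fixing_of_mem_extId hφ
    rw [hc, map_sub, ← hext, h.apply_apply hX hΨ c.2, sub_self]
  · intro ha
    refine ⟨_, h.restrict_mem_extId hX, -a, ?_⟩
    change (a : H →L[ℂ] H) = E (-(a : H →L[ℂ] H)) - -(a : H →L[ℂ] H)
    rw [map_neg, ha, neg_zero, zero_sub, neg_neg]

end OperatorSpace

theorem mainTheorem6 {H : Type*} [NormedAddCommGroup H] [InnerProductSpace ℂ H] [CompleteSpace H]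
    (X : Submodule ℂ (H →L[ℂ] H)) (hX : (1 : H →L[ℂ] H) ∈ X) :
    ∃ I : TwoSidedIdeal (OperatorSpace.cstar X),
      OperatorSpace.IsSilovIdeal X I ∧
      (⋃ φ ∈ OperatorSpace.extId X, OperatorSpace.abnormalities φ) =
        (I : Set (OperatorSpace.cstar X)) ∧
      IsClosed (⋃ φ ∈ OperatorSpace.extId X, OperatorSpace.abnormalities φ) := by
  obtain ⟨E, hE⟩ := OperatorSpace.exists_isRigid X
  refine ⟨hE.ideal hX, hE.isSilovIdeal hX, hE.iUnion_abnormalities hX, ?_⟩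
  rw [hE.iUnion_abnormalities hX]
  exact (hE.isBoundaryIdeal hX).isClosed
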